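/- Let $n,k\ge 0$, let $f=\{f_1,\dots,f_k\}$ be polynomials in $\mathbb{R}[x_1,\dots,x_n]$, let $\beta>0$ be a real constant, and let $h=\{h_1,\dots,h_k\}$ with $h_i=f_i+w_i/\sqrt{\beta}\in\mathbb{R}[x_1,\dots,x_n,w_1,\dots,w_k]$. Then the real zero set $M=V_{\mathbb{R}}(h)\subset\mathbb{R}^{n+k}$ is a smooth embedded $n$-dimensional submanifold, and it has a tubular neighborhood $U\subset\mathbb{R}^{n+k}$ with the properties (1) and (2) below. Here a tubular neighborhood of $M$ is an open set $U\supseteq M$ that is the diffeomorphic image, under $E(p,v)=p+v$, of $\{(p,v)\in NM:\|v\|_2<\delta(p)\}$ for some positive continuous function $\delta:M\to\mathbb{R}$, where $NM=\{(p,v): p\in M,\ v\perp T_pM\}$ is the normal bundle of $M$. For every point $(\mathfrak{a},b)\in U$ (with $\mathfrak{a}\in\mathbb{R}^n$, $b\in\mathbb{R}^k$): (1) there is a unique point $(x^*,w^*)\in V_{\mathbb{R}}(h)$ at minimum Euclidean distance from $(\mathfrak{a},b)$; (2) $(x^*,w^*)$ is the projection of a unique zero $(x^*,w^*,\lambda^*)$,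 $\lambda^*\in\mathbb{R}^k$, of the Lagrange system of the problem $\min\ (\|x-\mathfrak{a}\|_2^2+\|w-b\|_2^2)/2$ subject to $h=0$, that is, of the system of $n+2k$ polynomial equations in the unknowns $(x,w,\lambda)$ $$\begin{pmatrix}x-\mathfrak{a}\\ w-b\end{pmatrix}=\sum_{j=1}^k\lambda_j\,\nabla h_j(x,w),\qquad h_1(x,w)=\dots=h_k(x,w)=0,$$ and this zero is isolated (even in the set of complex zeros of the system) and simple (the Jacobian matrix of the system is nonsingular there). -/

import Mathlib

open scoped ContDiff Topology

noncomputable section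

/-! ### Submanifolds of a Euclidean space and tubular neighborhoods -/

section Geometry

variable {E : Type*} [NormedAddCommGroup E] [InnerProductSpace ℝ E]

/-- `M ⊆ E` is a smooth embedded submanifold of dimension `d`: around each of its points there is
a smooth chart of the ambient space `E` in which `M` is a slice, that is, the intersection of the
domain with a `d`-dimensional linear subspace. -/
def IsEmbeddedSubmanifold (d : ℕ) (M : Set E) : Prop :=
  ∀ p ∈ M, ∃ (φ : OpenPartialHomeomorph E E) (S : Submodule ℝ E),
    p ∈ φ.source ∧ ContDiffOn ℝ ∞ φ φ.source ∧ ContDiffOn ℝ ∞ φ.symm φ.target ∧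
      Module.finrank ℝ S = d ∧ ∀ q ∈ φ.source, q ∈ M ↔ φ q ∈ S

/-- `u` is tangent to `M` at `p`: it is the velocity at time `0` of a smooth curve in `M`
through `p`. -/
def IsTangentVector (M : Set E) (p u : E) : Prop :=
  ∃ (γ : ℝ → E) (ε : ℝ), 0 < ε ∧ ContDiffOn ℝ ∞ γ (Set.Ioo (-ε) ε) ∧
    (∀ t ∈ Set.Ioo (-ε) ε, γ t ∈ M) ∧ γ 0 = p ∧ HasDerivAt γ u 0

/-- The normal space `N_p M`: all vectors orthogonal to the tangent space of `M` at `p`. -/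
def normalSpace (M : Set E) (p : E) : Submodule ℝ E :=
  (Submodule.span ℝ {u | IsTangentVector M p u})ᗮ

/-- The normal bundle `NM = {(p, v) | p ∈ M, v ∈ N_p M}`, as a subset of `TE = E × E`. -/
def normalBundle (M : Set E) : Set (E × E) :=
  {q | q.1 ∈ M ∧ q.2 ∈ normalSpace M q.1}

/-- The open subset `{(p, v) ∈ NM | ‖v‖ < δ p}` of the normal bundle. -/
def normalTube (M : Set E) (δ : E → ℝ) : Set (E × E) :=
  {q | q ∈ normalBundle M ∧ ‖q.2‖ < δ q.1}

/-- `U` is a tubular neighborhood of `M`: an open set containing `M` that is the diffeomorphic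
image, under `(p, v) ↦ p + v`, of the tube `{(p, v) ∈ NM | ‖v‖ < δ p}` for some positive
continuous function `δ` on `M`.

The map `(p, v) ↦ p + v` is smooth on all of `E × E`, so it is a diffeomorphism from the tube
onto `U` when it is a bijection between the two whose inverse `G` is smooth. Here `G` is smooth as
a map from the open set `U` to the ambient space `E × E` of the normal bundle, which is the same
as being smooth as a map into the embedded submanifold `NM`. -/
def IsTubularNeighborhood (M U : Set E) : Prop :=
  IsOpen U ∧ M ⊆ U ∧
    ∃ δ : E → ℝ, ContinuousOn δ M ∧ (∀ p ∈ M, 0 < δ p) ∧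
      Set.BijOn (fun q : E × E => q.1 + q.2) (normalTube M δ) U ∧
      ∃ G : E → E × E, ContDiffOn ℝ ∞ G U ∧
        Set.InvOn G (fun q : E × E => q.1 + q.2) (normalTube M δ) U

/-- `p` is a point of `M` at minimum distance to `c`. -/
def IsClosestPoint (M : Set E) (c p : E) : Prop :=
  p ∈ M ∧ ∀ q ∈ M, dist c p ≤ dist c q

end Geometry

/-! ### Polynomial systems -/

section Systems

variable {σ ι : Type*}

/-- `z` is a common zero, with coordinates in `K`, of the real polynomials `F i`. -/
def IsZeroOf (K : Type*) [CommRing K] [Algebra ℝ K]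
    (F : ι → MvPolynomial σ ℝ) (z : σ → K) : Prop :=
  ∀ i, MvPolynomial.aeval z (F i) = 0

/-- `V_ℝ(F)`, the real zero set of `F`, in Euclidean space. -/
def realZeroSet (F : ι → MvPolynomial σ ℝ) : Set (EuclideanSpace ℝ σ) :=
  {p | IsZeroOf ℝ F (fun s => p s)}

/-- The real zero `z` is isolated, even among the complex zeros of the system. -/
def IsIsolatedZero (F : ι → MvPolynomial σ ℝ) (z : σ → ℝ) : Prop :=
  IsZeroOf ℝ F z ∧
    ∀ᶠ y in 𝓝 (fun s => (z s : ℂ)), IsZeroOf ℂ F y → y = fun s => (z s : ℂ)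

/-- The zero `z` of a square system is simple: the Jacobian matrix is nonsingular at `z`. -/
def IsSimpleZero [Fintype σ] [DecidableEq σ]
    (F : σ → MvPolynomial σ ℝ) (z : σ → ℝ) : Prop :=
  IsZeroOf ℝ F z ∧
    (Matrix.of fun i j => MvPolynomial.eval z (MvPolynomial.pderiv j (F i))).det ≠ 0

/-- The Lagrange system of the problem `min ‖y - c‖² / 2` subject to `h = 0`, in the variables `y`
(indexed by `σ`) and the multipliers `lam` (indexed by `ι`): the equations
`y_s - c_s = ∑ j, (∂h_j / ∂y_s) lam_j` for all `s`, and `h_j(y) = 0` for all `j`. -/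
def lagrangeSystem [Fintype ι] (h : ι → MvPolynomial σ ℝ) (c : σ → ℝ) :
    σ ⊕ ι → MvPolynomial (σ ⊕ ι) ℝ
  | Sum.inl s => MvPolynomial.X (Sum.inl s) - MvPolynomial.C (c s) -
      ∑ j, MvPolynomial.rename Sum.inl (MvPolynomial.pderiv s (h j)) *
        MvPolynomial.X (Sum.inr j)
  | Sum.inr j => MvPolynomial.rename Sum.inl (h j)

/-- The system `h_i = f_i + w_i / √β` in the variables `x_1, …, x_n` (the left summand) and
`w_1, …, w_k` (the right summand). -/
def slackSystem {n k : ℕ} (f : Fin k → MvPolynomial (Fin n) ℝ) (β : ℝ) :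
    Fin k → MvPolynomial (Fin n ⊕ Fin k) ℝ :=
  fun i => MvPolynomial.rename Sum.inl (f i) +
    MvPolynomial.C (1 / √β) * MvPolynomial.X (Sum.inr i)

end Systems

end

noncomputable section

/-! ### Polynomial maps: derivatives, Taylor estimates, simple zeros -/

section PolynomialMaps

variable {σ : Type*} [Fintype σ]

/-! The zero set $M$ is the graph $w=-\sqrt\beta\,f(x)$, straightened by the global chart
$(x,w)\mapsto(x,h(x,w))$. The $w$-part of $\nabla h_j$ is $e_j/\sqrt\beta$, so the gradients are
independent. The normal vectors at $p$ are exactly $v=-\sum_j\lambda_j\nabla h_j(p)$, with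
$\lambda_j=-\sqrt\beta\,v_{w_j}$, hence $|\lambda_j|\le\sqrt\beta\,\|v\|$
(`eq_neg_gradComb_of_mem_normalSpace`).

Let $C(p)$ be a continuous bound on the Taylor remainders and Hessians of the $h_j$ at $p$. If
$\|v\|$ is small compared with $1/C(p)$, two things follow. The first-order terms of $h_j$ between
points $p,q$ of $M$ are $O(\|q-p\|^2)$, so $p$ is strictly closest to $p+v$
(`dist_lt_dist_of_gradComb`). The Hessian of the Lagrangian stays positive definite, so the Lagrange
zero is simple (`isSimpleZero_lagrangeSystem`).

Strict closeness makes $(p,v)\mapsto p+v$ injective on the tube. Simplicity, through the inverse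
function theorem, makes its image open and its inverse smooth (`isTubularNeighborhood_image`). Over
$\mathbb{C}$ the same theorem isolates the zero. -/

theorem MvPolynomial.hasStrictFDerivAt_aeval {𝕜 : Type*} [NontriviallyNormedField 𝕜] [Algebra ℝ 𝕜]
    (P : MvPolynomial σ ℝ) (z : σ → 𝕜) :
    HasStrictFDerivAt (fun y : σ → 𝕜 => aeval y P)
      (∑ j, aeval z (pderiv j P) • (ContinuousLinearMap.proj j : (σ → 𝕜) →L[𝕜] 𝕜)) z := by
  classical
  induction P using MvPolynomial.induction_on with
  | C a =>
    refine HasStrictFDerivAt.congr_fderiv (f' := 0) ?_ ?_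
    · simpa using hasStrictFDerivAt_const (𝕜 := 𝕜) (algebraMap ℝ 𝕜 a) z
    · ext u
      simp
  | add p q hp hq =>
    simp only [map_add]
    refine (hp.fun_add hq).congr_fderiv ?_
    rw [← Finset.sum_add_distrib]
    exact Finset.sum_congr rfl fun s _ => (add_smul _ _ _).symm
  | mul_X p i hp =>
    have h := hp.mul (hasStrictFDerivAt_apply (𝕜 := 𝕜) (F' := fun _ : σ => 𝕜) i z)
    simp only [map_mul, aeval_X]
    refine h.congr_fderiv ?_
    ext u
    have hs (x : σ) : aeval z (pderiv x (p * X i)) * u x =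
        (if i = x then aeval z p * u x else 0) + z i * (aeval z (pderiv x p) * u x) := by
      rw [pderiv_mul, pderiv_X]
      rcases eq_or_ne i x with rfl | hix
      · simp
        ring
      · simp [hix]
        ring
    simp only [sum_apply, add_apply, smul_apply, ContinuousLinearMap.proj_apply,
      smul_eq_mul, hs, Finset.sum_add_distrib, Finset.mul_sum, Finset.sum_ite_eq, Finset.mem_univ,
      if_true]

theorem MvPolynomial.contDiff_aeval (P : MvPolynomial σ ℝ) (m : WithTop ℕ∞) :
    ContDiff ℝ m (fun y : σ → ℝ => aeval y P) := by
  induction P using MvPolynomial.induction_on with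
  | C a => simpa using contDiff_const
  | add p q hp hq => simpa only [map_add] using hp.add hq
  | mul_X p i hp => simpa only [map_mul, aeval_X] using hp.mul (contDiff_apply ℝ ℝ i)

/-- Induction on $P$: if $R_P$ is the remainder of $P$, that of $P X_i$ is $q_i
R_P+(q_i-p_i)\,dP_p(q-p)$, and the last term is visibly quadratic in $q-p$. -/
theorem MvPolynomial.exists_taylor_bound (P : MvPolynomial σ ℝ) :
    ∃ B : EuclideanSpace ℝ σ × EuclideanSpace ℝ σ → ℝ, Continuous B ∧
      ∀ p q : EuclideanSpace ℝ σ,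
        |aeval (fun s => q s) P - aeval (fun s => p s) P -
          ∑ s, aeval (fun s => p s) (pderiv s P) * (q s - p s)| ≤ B (p, q) * ‖q - p‖ ^ 2 := by
  classical
  have hcont (Q : MvPolynomial σ ℝ) :
      Continuous fun p : EuclideanSpace ℝ σ => aeval (fun s => p s) Q :=
    (Q.contDiff_aeval 0).continuous.comp (by fun_prop)
  have hle (p q : EuclideanSpace ℝ σ) (s : σ) : |q s - p s| ≤ ‖q - p‖ := by
    simpa using PiLp.norm_apply_le (q - p) s
  induction P using MvPolynomial.induction_on with
  | C a => exact ⟨fun _ => 0, continuous_const, fun p q => by simp⟩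
  | add P Q hP hQ =>
    obtain ⟨B, hB, hB'⟩ := hP
    obtain ⟨D, hD, hD'⟩ := hQ
    refine ⟨fun z => B z + D z, hB.add hD, fun p q => ?_⟩
    rw [add_mul]
    refine le_trans (le_of_eq ?_) ((abs_add_le _ _).trans (add_le_add (hB' p q) (hD' p q)))
    simp only [map_add, add_mul, Finset.sum_add_distrib]
    congr 1
    ring
  | mul_X P i hP =>
    obtain ⟨B, hB, hB'⟩ := hP
    refine ⟨fun z => |z.2 i| * B z + ∑ s, |aeval (fun t => z.1 t) (pderiv s P)|, ?_, fun p q => ?_⟩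
    · have h1 := fun s => ((hcont (pderiv s P)).comp
        (continuous_fst (X := EuclideanSpace ℝ σ) (Y := EuclideanSpace ℝ σ))).abs
      have h2 : Continuous fun z : EuclideanSpace ℝ σ × EuclideanSpace ℝ σ => |z.2 i| := by fun_prop
      exact (h2.mul hB).add (continuous_finsetSum _ fun s _ => h1 s)
    · have hlin : |(q i - p i) * ∑ s, aeval (fun s => p s) (pderiv s P) * (q s - p s)| ≤
          (∑ s, |aeval (fun t => p t) (pderiv s P)|) * ‖q - p‖ ^ 2 := by
        rw [Finset.mul_sum, Finset.sum_mul]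
        refine (Finset.abs_sum_le_sum_abs _ _).trans (Finset.sum_le_sum fun s _ => ?_)
        rw [abs_mul, abs_mul, pow_two]
        calc _ = |aeval (fun t => p t) (pderiv s P)| * (|q i - p i| * |q s - p s|) := by ring
          _ ≤ _ := by gcongr <;> exact hle p q _
      have hrem := mul_le_mul_of_nonneg_left (hB' p q) (abs_nonneg (q i))
      rw [← abs_mul, ← mul_assoc] at hrem
      rw [add_mul]
      refine le_trans (le_of_eq ?_) ((abs_add_le _ _).trans (add_le_add hrem hlin))
      congr 1
      simp only [Derivation.leibniz, pderiv_X, map_add, map_mul, aeval_X, smul_eq_mul,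
        add_mul, Finset.sum_add_distrib, Pi.single_apply, apply_ite, map_one, map_zero]
      have : ∑ s, p i * aeval (fun s => p s) (pderiv s P) * (q s - p s) =
          p i * ∑ s, aeval (fun s => p s) (pderiv s P) * (q s - p s) := by
        rw [Finset.mul_sum]
        exact Finset.sum_congr rfl fun s _ => by ring
      simp only [mul_one, mul_zero, ite_mul, zero_mul, Finset.sum_ite_eq,
        Finset.mem_univ, if_true, this]
      ring

/-- The first-order Taylor remainders and the Hessians of finitely many polynomials are bounded by one
continuous function of the base point. -/
theorem MvPolynomial.exists_continuous_bound {ι : Type*} [Finite ι] (h : ι → MvPolynomial σ ℝ) :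
    ∃ C : EuclideanSpace ℝ σ → ℝ, Continuous C ∧ (∀ p, 0 ≤ C p) ∧
      (∀ j p q, ‖q - p‖ ≤ 1 →
        |aeval (fun s => q s) (h j) - aeval (fun s => p s) (h j) -
          ∑ s, aeval (fun s => p s) (pderiv s (h j)) * (q s - p s)| ≤ C p * ‖q - p‖ ^ 2) ∧
      ∀ j p, ∑ s, ∑ t, |aeval (fun s => p s) (pderiv t (pderiv s (h j)))| ≤ C p := by
  choose B hB hB' using fun j => exists_taylor_bound (h j)
  have hcont (Q : MvPolynomial σ ℝ) :
      Continuous fun p : EuclideanSpace ℝ σ => aeval (fun s => p s) Q :=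
    (Q.contDiff_aeval 0).continuous.comp (by fun_prop)
  let Hs : ι → EuclideanSpace ℝ σ → ℝ := fun j p =>
    ∑ s, ∑ t, |aeval (fun s => p s) (pderiv t (pderiv s (h j)))|
  have hHs (j : ι) : Continuous (Hs j) :=
    continuous_finsetSum _ fun s _ => continuous_finsetSum _ fun t _ => (hcont _).abs
  -- The admissible constants at $p$ form an upward closed set, hence a convex one, so locally
  -- constant choices glue to a continuous function.
  let T : EuclideanSpace ℝ σ → Set ℝ := fun p => {c | 0 ≤ c ∧ (∀ j q, ‖q - p‖ ≤ 1 →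
        |aeval (fun s => q s) (h j) - aeval (fun s => p s) (h j) -
          ∑ s, aeval (fun s => p s) (pderiv s (h j)) * (q s - p s)| ≤ c * ‖q - p‖ ^ 2) ∧
      ∀ j, Hs j p ≤ c}
  have hT (p : EuclideanSpace ℝ σ) : Convex ℝ (T p) := by
    refine Set.OrdConnected.convex ⟨fun a ha b _ c hc => ⟨ha.1.trans hc.1, fun j q hq => ?_,
      fun j => (ha.2.2 j).trans hc.1⟩⟩
    exact (ha.2.1 j q hq).trans (mul_le_mul_of_nonneg_right hc.1 (by positivity))
  obtain ⟨C, hC⟩ := exists_continuous_forall_mem_convex_of_local_const hT fun p₀ => by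
    -- Radius 2 suffices: $p$ ranges over the unit ball about $p_0$, and $\|q-p\|\le1$.
    have hK : IsCompact (Metric.closedBall p₀ 2 ×ˢ Metric.closedBall p₀ 2) :=
      (isCompact_closedBall p₀ 2).prod (isCompact_closedBall p₀ 2)
    choose b hb using fun j => hK.exists_bound_of_continuousOn (hB j).continuousOn
    choose d hd using fun j =>
      (isCompact_closedBall p₀ 2).exists_bound_of_continuousOn (hHs j).continuousOn
    have := Fintype.ofFinite ι
    have hmem : p₀ ∈ Metric.closedBall p₀ 2 := Metric.mem_closedBall_self (by norm_num)
    have hb0 (j : ι) : 0 ≤ b j := (norm_nonneg _).trans (hb j (p₀, p₀) ⟨hmem, hmem⟩)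
    have hd0 (j : ι) : 0 ≤ d j := (norm_nonneg _).trans (hd j p₀ hmem)
    have hle (j : ι) : b j + d j ≤ ∑ j, (b j + d j) :=
      Finset.single_le_sum (f := fun j => b j + d j) (fun j _ => add_nonneg (hb0 j) (hd0 j))
        (Finset.mem_univ j)
    refine ⟨∑ j, (b j + d j), ?_⟩
    filter_upwards [Metric.closedBall_mem_nhds p₀ one_pos] with p hp
    rw [Metric.mem_closedBall] at hp
    have hp2 : p ∈ Metric.closedBall p₀ 2 := Metric.mem_closedBall.2 (hp.trans (by norm_num))
    refine ⟨Finset.sum_nonneg fun j _ => add_nonneg (hb0 j) (hd0 j), fun j q hq => ?_, fun j => ?_⟩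
    · have hq2 : q ∈ Metric.closedBall p₀ 2 := by
        rw [Metric.mem_closedBall]
        have := dist_triangle q p p₀
        rw [dist_eq_norm q p] at this
        linarith
      refine (hB' j p q).trans (mul_le_mul_of_nonneg_right ?_ (by positivity))
      exact (le_abs_self _).trans ((hb j (p, q) ⟨hp2, hq2⟩).trans (by linarith [hle j, hd0 j]))
    · exact (le_abs_self _).trans ((hd j p hp2).trans (by linarith [hle j, hb0 j]))
  exact ⟨C, C.continuous, fun p => (hC p).1, fun j p q => (hC p).2.1 j q, fun j p => (hC p).2.2 j⟩

/-- The input to the inverse function theorem, used over $\mathbb{C}$ to isolate zeros and over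
$\mathbb{R}$ to solve the Lagrange system smoothly. -/
theorem MvPolynomial.exists_hasStrictFDerivAt_equiv [DecidableEq σ] {𝕜 : Type*}
    [NontriviallyNormedField 𝕜] [CompleteSpace 𝕜] [Algebra ℝ 𝕜] (F : σ → MvPolynomial σ ℝ)
    (z : σ → 𝕜) (hz : (Matrix.of fun i j => aeval z (pderiv j (F i))).det ≠ 0) :
    ∃ e : (σ → 𝕜) ≃L[𝕜] (σ → 𝕜),
      HasStrictFDerivAt (fun (y : σ → 𝕜) i => aeval y (F i)) (e : (σ → 𝕜) →L[𝕜] (σ → 𝕜)) z := by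
  set J : Matrix σ σ 𝕜 := Matrix.of fun i j => aeval z (pderiv j (F i)) with hJ
  refine ⟨(Matrix.toLinearEquiv' J (J.invertibleOfIsUnitDet (Ne.isUnit hz))).toContinuousLinearEquiv,
    ?_⟩
  refine hasStrictFDerivAt_pi'.2 fun i => ((F i).hasStrictFDerivAt_aeval z).congr_fderiv ?_
  ext u
  rw [sum_apply]
  rfl

/-- The complex Jacobian determinant at a real point is the real one, so the system is locally
invertible over $\mathbb{C}$ and takes the value $0$ only once nearby. -/
theorem IsSimpleZero.isIsolatedZero [DecidableEq σ] {F : σ → MvPolynomial σ ℝ} {z : σ → ℝ}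
    (hz : IsSimpleZero F z) : IsIsolatedZero F z := by
  refine ⟨hz.1, ?_⟩
  have haeval (P : MvPolynomial σ ℝ) : MvPolynomial.aeval (fun s => (z s : ℂ)) P =
      ((MvPolynomial.eval z P : ℝ) : ℂ) := by
    have := MvPolynomial.aeval_algebraMap_apply (A := ℝ) ℂ z P
    rwa [MvPolynomial.aeval_eq_eval] at this
  obtain ⟨e, he⟩ := MvPolynomial.exists_hasStrictFDerivAt_equiv F (fun s => (z s : ℂ)) (by
    simp only [haeval]
    have := (RingHom.map_det (algebraMap ℝ ℂ)
      (Matrix.of fun i j => MvPolynomial.eval z (MvPolynomial.pderiv j (F i))))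
    intro h0
    apply hz.2
    apply (algebraMap ℝ ℂ).injective
    rw [this, map_zero, ← h0]
    rfl)
  have hz0 : (fun i => MvPolynomial.aeval (fun s => (z s : ℂ)) (F i)) = 0 := by
    funext i
    have := hz.1 i
    rw [MvPolynomial.aeval_eq_eval] at this
    rw [haeval]
    simpa using this
  filter_upwards [he.eventually_left_inverse] with y hy hy0
  have hy0' : (fun i => MvPolynomial.aeval y (F i)) = 0 := funext hy0
  rw [← hy, hy0', ← hz0, he.localInverse_apply_image]

end PolynomialMaps

/-! ### The Lagrange system of a closest-point problem -/

section LagrangeEquations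

variable {σ ι : Type*} [Fintype ι]

/-- The linear combination `∑ j, lam_j ∇h_j(p)` of the gradients. -/
def gradComb (h : ι → MvPolynomial σ ℝ) (p : EuclideanSpace ℝ σ) (lam : ι → ℝ) :
    EuclideanSpace ℝ σ :=
  WithLp.toLp 2 fun s => ∑ j, MvPolynomial.aeval (fun t => p t) (MvPolynomial.pderiv s (h j)) * lam j

variable {h : ι → MvPolynomial σ ℝ}

theorem aeval_lagrangeSystem_inl (c : σ → ℝ) (y : σ → ℝ) (lam : ι → ℝ) (s : σ) :
    MvPolynomial.aeval (Sum.elim y lam) (lagrangeSystem h c (Sum.inl s)) =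
      y s - c s - ∑ j, MvPolynomial.aeval y (MvPolynomial.pderiv s (h j)) * lam j := by
  simp only [lagrangeSystem, map_sub, map_sum, map_mul, MvPolynomial.aeval_X, MvPolynomial.aeval_C,
    MvPolynomial.aeval_rename, Sum.elim_inl, Sum.elim_inr, Sum.elim_comp_inl]
  rfl

theorem aeval_lagrangeSystem_inr (c : σ → ℝ) (y : σ → ℝ) (lam : ι → ℝ) (j : ι) :
    MvPolynomial.aeval (Sum.elim y lam) (lagrangeSystem h c (Sum.inr j)) =
      MvPolynomial.aeval y (h j) := by
  simp only [lagrangeSystem, MvPolynomial.aeval_rename, Sum.elim_comp_inl]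

theorem isZeroOf_lagrangeSystem_iff {c p : EuclideanSpace ℝ σ} {lam : ι → ℝ} :
    IsZeroOf ℝ (lagrangeSystem h (fun s => c s)) (Sum.elim (fun s => p s) lam) ↔
      p ∈ realZeroSet h ∧ c = p + -gradComb h p lam := by
  rw [IsZeroOf, Sum.forall, and_comm]
  simp only [aeval_lagrangeSystem_inl, aeval_lagrangeSystem_inr]
  refine and_congr Iff.rfl ?_
  rw [PiLp.ext_iff]
  refine forall_congr' fun s => ?_
  simp only [gradComb, PiLp.add_apply, PiLp.neg_apply]
  constructor <;> intro h <;> linarith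

end LagrangeEquations

/-! ### Simple zeros, strict minimality and the tube they produce -/

section Lagrange

variable {σ ι : Type*} [Fintype σ] [Fintype ι] {h : ι → MvPolynomial σ ℝ}

theorem inner_gradComb (p u : EuclideanSpace ℝ σ) (lam : ι → ℝ) :
    inner ℝ (gradComb h p lam) u =
      ∑ j, lam j * ∑ s, MvPolynomial.aeval (fun t => p t) (MvPolynomial.pderiv s (h j)) * u s := by
  simp only [gradComb, PiLp.inner_apply, RCLike.inner_apply, conj_trivial, Finset.mul_sum]
  rw [Finset.sum_comm]
  exact Finset.sum_congr rfl fun s _ => Finset.sum_congr rfl fun j _ => by ring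

theorem MvPolynomial.pderiv_inr_rename_inl {R τ υ : Type*} [CommSemiring R] (i : υ)
    (P : MvPolynomial τ R) : pderiv (Sum.inr i) (rename (Sum.inl : τ → τ ⊕ υ) P) = 0 := by
  classical
  refine pderiv_eq_zero_of_notMem_vars fun hi => ?_
  obtain ⟨x, -, hx⟩ := Finset.mem_image.1 (vars_rename Sum.inl P hi)
  cases hx

/-- A zero of the Lagrange system with linearly independent gradients whose multipliers are small
compared with the Hessians of the constraints is simple. -/
theorem isSimpleZero_lagrangeSystem [DecidableEq σ] [DecidableEq ι] {c p : EuclideanSpace ℝ σ}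
    {lam : ι → ℝ} {C : ℝ}
    (hC : ∀ j, ∑ s, ∑ t, |MvPolynomial.aeval (fun s => p s)
      (MvPolynomial.pderiv t (MvPolynomial.pderiv s (h j)))| ≤ C)
    (hlam : (∑ j, |lam j|) * C < 1) (hli : ∀ mu, gradComb h p mu = 0 → mu = 0)
    (hz : IsZeroOf ℝ (lagrangeSystem h (fun s => c s)) (Sum.elim (fun s => p s) lam)) :
    IsSimpleZero (lagrangeSystem h (fun s => c s)) (Sum.elim (fun s => p s) lam) := by
  refine ⟨hz, fun hdet => ?_⟩
  obtain ⟨w, hw, hJ⟩ := Matrix.exists_mulVec_eq_zero_iff.2 hdet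
  set H : σ → σ → ι → ℝ := fun s t j => MvPolynomial.aeval (fun s => p s)
      (MvPolynomial.pderiv t (MvPolynomial.pderiv s (h j))) with hH
  set u : EuclideanSpace ℝ σ := WithLp.toLp 2 fun s => w (Sum.inl s) with hu
  set mu : ι → ℝ := fun j => w (Sum.inr j) with hmu
  -- For a kernel vector $(u,\mu)$ of the Jacobian, the upper block says
  -- $u=\sum_j\lambda_jH_ju+\sum_j\mu_j\nabla h_j$; the lower block says $u\perp\nabla h_j$.
  have hinl (s : σ) : u s = (∑ j, lam j * ∑ t, H s t j * u t) + gradComb h p mu s := by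
    have := congrFun hJ (Sum.inl s)
    simp only [Matrix.mulVec, dotProduct, Fintype.sum_sum_type, Matrix.of_apply, lagrangeSystem,
      map_sub, map_sum, MvPolynomial.pderiv_C, MvPolynomial.pderiv_mul,
      MvPolynomial.pderiv_rename Sum.inl_injective, MvPolynomial.pderiv_inr_rename_inl,
      MvPolynomial.pderiv_X, Pi.single_apply, reduceCtorEq, if_false, Sum.inr.injEq, mul_zero, add_zero, zero_mul, zero_add, sub_zero,
      map_mul, MvPolynomial.eval_X, MvPolynomial.eval_rename, Sum.elim_inr, apply_ite
      (MvPolynomial.eval (Sum.elim (fun s => p s) lam)), map_one, map_zero, Pi.zero_apply,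
      mul_ite, mul_one, Finset.sum_ite_eq, Finset.mem_univ, if_true, Sum.elim_comp_inl,
      sub_mul, Finset.sum_sub_distrib, ite_mul, one_mul, Finset.sum_mul, Finset.sum_ite_eq'] at this
    simp only [gradComb, hH, hu, hmu, MvPolynomial.aeval_eq_eval]
    rw [Finset.sum_comm] at this
    simp only [Finset.mul_sum]
    have e : ∀ j t, lam j * ((MvPolynomial.eval fun s => p s)
          (MvPolynomial.pderiv t (MvPolynomial.pderiv s (h j))) * w (Sum.inl t)) =
        (MvPolynomial.eval fun s => p s)
          (MvPolynomial.pderiv t (MvPolynomial.pderiv s (h j))) * lam j * w (Sum.inl t) :=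
      fun j t => by ring
    simp only [e]
    linarith
  have hinr (j : ι) :
      ∑ s, MvPolynomial.aeval (fun t => p t) (MvPolynomial.pderiv s (h j)) * u s = 0 := by
    have := congrFun hJ (Sum.inr j)
    simpa [Matrix.mulVec, dotProduct, Fintype.sum_sum_type, lagrangeSystem,
      MvPolynomial.pderiv_rename Sum.inl_injective, MvPolynomial.pderiv_inr_rename_inl,
      MvPolynomial.eval_rename, MvPolynomial.aeval_eq_eval] using this
  have horth : ∑ s, gradComb h p mu s * u s = 0 := by
    have h1 := inner_gradComb (h := h) p u mu
    simp only [hinr, mul_zero, Finset.sum_const_zero] at h1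
    rw [← h1]
    simp [PiLp.inner_apply, mul_comm]
  -- Pairing the upper block with $u$ removes $\mu$; the bound on the multipliers then forces $u=0$,
  -- and independence of the gradients gives $\mu=0$.
  have hnorm : ‖u‖ ^ 2 = ∑ j, lam j * ∑ s, ∑ t, H s t j * (u t * u s) := by
    rw [EuclideanSpace.norm_sq_eq]
    calc ∑ s, ‖u s‖ ^ 2 = ∑ s, ((∑ j, lam j * ∑ t, H s t j * u t) + gradComb h p mu s) * u s :=
          Finset.sum_congr rfl fun s _ => by rw [← hinl, Real.norm_eq_abs, sq_abs, pow_two]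
      _ = ∑ s, ∑ j, lam j * ∑ t, H s t j * (u t * u s) := by
          simp only [add_mul, Finset.sum_add_distrib, horth, add_zero, Finset.sum_mul,
            Finset.mul_sum, mul_assoc]
      _ = _ := by
          rw [Finset.sum_comm]
          exact Finset.sum_congr rfl fun j _ => by rw [Finset.mul_sum]
  have hbound : ‖u‖ ^ 2 ≤ (∑ j, |lam j|) * C * ‖u‖ ^ 2 := by
    nth_rewrite 1 [hnorm]
    rw [Finset.sum_mul, Finset.sum_mul]
    refine Finset.sum_le_sum fun j _ => (le_abs_self _).trans ?_
    rw [abs_mul, mul_assoc]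
    refine mul_le_mul_of_nonneg_left ?_ (abs_nonneg _)
    refine le_trans ?_ (mul_le_mul_of_nonneg_right (hC j) (by positivity))
    rw [Finset.sum_mul]
    refine (Finset.abs_sum_le_sum_abs _ _).trans (Finset.sum_le_sum fun s _ => ?_)
    rw [Finset.sum_mul]
    refine (Finset.abs_sum_le_sum_abs _ _).trans (Finset.sum_le_sum fun t _ => ?_)
    rw [abs_mul, abs_mul, pow_two]
    have hle (s : σ) : |u s| ≤ ‖u‖ := by simpa using PiLp.norm_apply_le u s
    gcongr <;> exact hle _
  have hu0 : u = 0 := by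
    by_contra hne
    have : 0 < ‖u‖ ^ 2 := by positivity
    nlinarith
  have hmu0 : mu = 0 := hli mu <| by
    ext s
    have := hinl s
    simp only [hu0, PiLp.zero_apply, mul_zero, Finset.sum_const_zero, zero_add] at this
    simpa using this.symm
  refine hw (funext fun i => ?_)
  rcases i with s | j
  · exact congrFun (congrArg WithLp.ofLp hu0) s
  · exact congrFun hmu0 j

/-- If `v` is a combination of the gradients at `p` that is short compared with the second-order
terms of the constraints, then `p` is the strictly closest point of the zero set to `p + v`. -/
theorem dist_lt_dist_of_gradComb {p q : EuclideanSpace ℝ σ} {lam : ι → ℝ} {C : ℝ}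
    (hC : ∀ j q, ‖q - p‖ ≤ 1 →
      |MvPolynomial.aeval (fun s => q s) (h j) - MvPolynomial.aeval (fun s => p s) (h j) -
        ∑ s, MvPolynomial.aeval (fun s => p s) (MvPolynomial.pderiv s (h j)) * (q s - p s)| ≤
          C * ‖q - p‖ ^ 2)
    (hp : p ∈ realZeroSet h) (hq : q ∈ realZeroSet h) (hne : q ≠ p)
    (hlam : (∑ j, |lam j|) * C < 1 / 2) (hv : ‖gradComb h p lam‖ < 1 / 2) :
    dist (p + -gradComb h p lam) p < dist (p + -gradComb h p lam) q := by
  set v := -gradComb h p lam with hvdef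
  have hpos : 0 < ‖q - p‖ := norm_pos_iff.2 (sub_ne_zero.2 hne)
  -- Expanding $\|v-(q-p)\|^2$ shows that this inequality is equivalent to strict closeness. Near
  -- $p$ it comes from Taylor's bound with $h_j(p)=h_j(q)=0$; at distance above 1, from
  -- Cauchy–Schwarz and $\|v\|<1/2$.
  have hinner : inner ℝ v (q - p) < ‖q - p‖ ^ 2 / 2 := by
    rcases le_or_gt ‖q - p‖ 1 with h1 | h1
    · have h2 : inner ℝ v (q - p) ≤ (∑ j, |lam j|) * C * ‖q - p‖ ^ 2 := by
        rw [hvdef, inner_neg_left, inner_gradComb, ← Finset.sum_neg_distrib, Finset.sum_mul,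
          Finset.sum_mul]
        refine Finset.sum_le_sum fun j _ => ?_
        have h3 := hC j q h1
        rw [hp j, hq j, sub_zero, zero_sub, abs_neg] at h3
        refine (le_abs_self _).trans ?_
        rw [abs_neg, abs_mul, mul_assoc]
        exact mul_le_mul_of_nonneg_left h3 (abs_nonneg _)
      have : 0 < ‖q - p‖ ^ 2 := by positivity
      nlinarith
    · have h2 := real_inner_le_norm v (q - p)
      have h3 : ‖v‖ < 1 / 2 := by rwa [hvdef, norm_neg]
      nlinarith
  rw [dist_eq_norm, dist_eq_norm, add_sub_cancel_left, show p + v - q = v - (q - p) by abel]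
  refine lt_of_pow_lt_pow_left₀ 2 (norm_nonneg _) ?_
  rw [norm_sub_sq_real]
  linarith

/-- Near a simple zero, the Lagrange system can be solved smoothly in the data point. -/
theorem exists_contDiffAt_lagrangeSystem_zero [DecidableEq σ] [DecidableEq ι]
    {c₀ : EuclideanSpace ℝ σ} {z₀ : σ ⊕ ι → ℝ}
    (hz : IsSimpleZero (lagrangeSystem h (fun s => c₀ s)) z₀) :
    ∃ Z : EuclideanSpace ℝ σ → σ ⊕ ι → ℝ, ContDiffAt ℝ ∞ Z c₀ ∧ Z c₀ = z₀ ∧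
      ∀ᶠ c in 𝓝 c₀, IsZeroOf ℝ (lagrangeSystem h (fun s => c s)) (Z c) := by
  set F := lagrangeSystem h (fun s => c₀ s) with hF
  let Ψ : (σ ⊕ ι → ℝ) → σ ⊕ ι → ℝ := fun y i => MvPolynomial.aeval y (F i)
  obtain ⟨e, he⟩ := MvPolynomial.exists_hasStrictFDerivAt_equiv F z₀ hz.2
  have hΨ : ContDiffAt ℝ ∞ Ψ z₀ :=
    contDiffAt_pi.2 fun i => ((F i).contDiff_aeval ∞).contDiffAt
  have hΨ0 : Ψ z₀ = 0 := funext hz.1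
  have hn : (∞ : WithTop ℕ∞) ≠ 0 := by simp
  -- The data point enters the system only additively: solving it for $c$ means solving
  -- $\Psi(y)=(c-c_0,0)$.
  let ε : EuclideanSpace ℝ σ → σ ⊕ ι → ℝ := fun c => Sum.elim (fun s => c s - c₀ s) 0
  have hε : ContDiff ℝ ∞ ε := by
    refine contDiff_pi.2 fun i => ?_
    rcases i with s | j
    · exact (show ContDiff ℝ ∞ fun c : EuclideanSpace ℝ σ => c s - c₀ s by fun_prop)
    · exact contDiff_const
  have hε0 : ε c₀ = 0 := by
    funext i
    rcases i with s | j <;> simp [ε]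
  have hinv := hΨ.to_localInverse he.hasFDerivAt hn
  have hright := he.eventually_right_inverse
  refine ⟨fun c => hΨ.localInverse he.hasFDerivAt hn (ε c), ?_, ?_, ?_⟩
  · refine ContDiffAt.comp c₀ (g := hΨ.localInverse he.hasFDerivAt hn) ?_ hε.contDiffAt
    rwa [hε0, ← hΨ0]
  · beta_reduce
    rw [hε0, ← hΨ0]
    exact hΨ.localInverse_apply_image he.hasFDerivAt hn
  · have htend : Filter.Tendsto ε (𝓝 c₀) (𝓝 (Ψ z₀)) := by
      rw [hΨ0, ← hε0]
      exact hε.continuous.continuousAt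
    filter_upwards [htend.eventually hright] with c hc i
    set z := hΨ.localInverse he.hasFDerivAt hn (ε c) with hzdef
    have hc' : Ψ z = ε c := hc
    have hzz : z = Sum.elim (fun s => z (Sum.inl s)) (fun j => z (Sum.inr j)) := by
      funext i
      rcases i with s | j <;> rfl
    have hi := congrFun hc' i
    simp only [Ψ, hF] at hi
    rw [hzz] at hi ⊢
    rcases i with s | j
    · rw [aeval_lagrangeSystem_inl] at hi ⊢
      simp only [ε, Sum.elim_inl] at hi
      linarith
    · rw [aeval_lagrangeSystem_inr] at hi ⊢
      exact hi

/-- A tube of normal vectors given by simple zeros of the Lagrange system, in which foot points are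
strictly closest, has a tubular neighborhood as its image. -/
theorem isTubularNeighborhood_image [DecidableEq σ] [DecidableEq ι] {δ : EuclideanSpace ℝ σ → ℝ}
    (hδ : Continuous δ) (hpos : ∀ p, 0 < δ p)
    (hgrad : ∀ p ∈ realZeroSet h, ∀ lam, -gradComb h p lam ∈ normalSpace (realZeroSet h) p)
    (hsimple : ∀ q ∈ normalTube (realZeroSet h) δ, ∃ lam,
      IsSimpleZero (lagrangeSystem h (fun s => (q.1 + q.2) s)) (Sum.elim (fun s => q.1 s) lam))
    (hclosest : ∀ q ∈ normalTube (realZeroSet h) δ, ∀ p ∈ realZeroSet h, p ≠ q.1 →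
      dist (q.1 + q.2) q.1 < dist (q.1 + q.2) p) :
    IsTubularNeighborhood (realZeroSet h)
      ((fun q : EuclideanSpace ℝ σ × EuclideanSpace ℝ σ => q.1 + q.2) ''
        normalTube (realZeroSet h) δ) := by
  set M := realZeroSet h with hM
  set T := normalTube M δ with hT
  let A : EuclideanSpace ℝ σ × EuclideanSpace ℝ σ → EuclideanSpace ℝ σ := fun q => q.1 + q.2
  change IsTubularNeighborhood M (A '' T)
  -- Two distinct foot points of one point would each be strictly closer than the other.
  have hinj : Set.InjOn A T := by
    intro q hq r hr hqr
    have hqr' : q.1 + q.2 = r.1 + r.2 := hqr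
    have h1 : q.1 = r.1 := by
      by_contra hne
      have h2 := hclosest q hq r.1 hr.1.1 (Ne.symm hne)
      have h3 := hclosest r hr q.1 hq.1.1 hne
      rw [hqr'] at h2
      exact lt_asymm h2 h3
    refine Prod.ext h1 ?_
    rw [h1] at hqr'
    exact add_left_cancel hqr'
  -- The $y$-part of the smooth Lagrange solution is a local foot-point map $P$; $c-P(c)$ is normal,
  -- and its length stays below $\delta$ by continuity.
  have hlocal (q) (hq : q ∈ T) : ∃ P : EuclideanSpace ℝ σ → EuclideanSpace ℝ σ,
      ContDiffAt ℝ ∞ P (A q) ∧ ∀ᶠ c in 𝓝 (A q), (P c, c - P c) ∈ T := by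
    obtain ⟨lam, hlam⟩ := hsimple q hq
    obtain ⟨Z, hZ, hZ0, hev⟩ := exists_contDiffAt_lagrangeSystem_zero (c₀ := A q) hlam
    let P : EuclideanSpace ℝ σ → EuclideanSpace ℝ σ := fun c => WithLp.toLp 2 fun s => Z c (Sum.inl s)
    have hP : ContDiffAt ℝ ∞ P (A q) :=
      contDiffAt_euclidean.2 fun s => contDiffAt_pi.1 hZ (Sum.inl s)
    have hP0 : P (A q) = q.1 := by
      ext s
      simp [P, hZ0]
    have hlt : ∀ᶠ c in 𝓝 (A q), ‖c - P c‖ < δ (P c) := by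
      refine ContinuousAt.eventually_lt ?_ ?_ ?_
      · exact (continuousAt_id.sub hP.continuousAt).norm
      · exact hδ.continuousAt.comp hP.continuousAt
      · rw [hP0]
        simpa [A] using hq.2
    refine ⟨P, hP, ?_⟩
    filter_upwards [hev, hlt] with c hc hc'
    have hZc : Z c = Sum.elim (fun s => P c s) (fun j => Z c (Sum.inr j)) := by
      funext i
      rcases i with s | j <;> rfl
    rw [hZc, isZeroOf_lagrangeSystem_iff] at hc
    have hsub : c - P c = -gradComb h (P c) (fun j => Z c (Sum.inr j)) :=
      sub_eq_of_eq_add' hc.2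
    exact ⟨⟨hc.1, hsub ▸ hgrad _ hc.1 _⟩, hc'⟩
  refine ⟨?_, ?_, δ, hδ.continuousOn, fun p _ => hpos p, ⟨Set.mapsTo_image _ _, hinj,
    Set.surjOn_image _ _⟩, Function.invFunOn A T, ?_, ?_, ?_⟩
  · rw [isOpen_iff_mem_nhds]
    rintro _ ⟨q, hq, rfl⟩
    obtain ⟨P, -, hP⟩ := hlocal q hq
    filter_upwards [hP] with c hc
    exact ⟨_, hc, add_sub_cancel _ _⟩
  · exact fun p hp => ⟨(p, 0), ⟨⟨hp, Submodule.zero_mem _⟩, by simpa using hpos p⟩, add_zero p⟩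
  · rintro _ ⟨q, hq, rfl⟩
    obtain ⟨P, hPs, hP⟩ := hlocal q hq
    -- By injectivity the set-theoretic inverse agrees near this point with $c\mapsto(P(c),c-P(c))$.
    refine ((hPs.prodMk (contDiffAt_id.sub hPs)).congr_of_eventuallyEq ?_).contDiffWithinAt
    filter_upwards [hP] with c hc
    have hAc : A (P c, c - P c) = c := add_sub_cancel _ _
    have hcT : c ∈ A '' T := ⟨_, hc, hAc⟩
    exact hinj (Function.invFunOn_mem hcT) hc ((Function.invFunOn_eq hcT).trans hAc.symm)
  · exact fun q hq => hinj.leftInvOn_invFunOn hq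
  · exact fun c hc => Function.invFunOn_eq hc

end Lagrange

/-! ### The slack system -/

/-- Each $h_j$ vanishes along a curve in the zero set; differentiating at time $0$ gives $\nabla
h_j\perp u$. -/
theorem gradComb_mem_normalSpace {σ ι : Type*} [Fintype σ] [Fintype ι] (h : ι → MvPolynomial σ ℝ)
    (p : EuclideanSpace ℝ σ) (lam : ι → ℝ) : gradComb h p lam ∈ normalSpace (realZeroSet h) p := by
  rw [normalSpace, Submodule.mem_orthogonal']
  intro u hu
  induction hu using Submodule.span_induction with
  | zero => exact inner_zero_right _
  | add x y _ _ hx hy => rw [inner_add_right, hx, hy, add_zero]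
  | smul a x _ hx => rw [inner_smul_right, hx, mul_zero]
  | mem u hu =>
    obtain ⟨γ, ε, hε, -, hγM, hγ0, hγ⟩ := hu
    rw [inner_gradComb]
    refine Finset.sum_eq_zero fun j _ => ?_
    have hγ' : HasDerivAt (fun t s => γ t s) (fun s => u s) 0 :=
      (EuclideanSpace.equiv σ ℝ).toContinuousLinearMap.hasFDerivAt.comp_hasDerivAt 0 hγ
    have h1 := ((h j).hasStrictFDerivAt_aeval (fun s => γ 0 s)).hasFDerivAt.comp_hasDerivAt 0 hγ'
    have h2 : (fun y => MvPolynomial.aeval y (h j)) ∘ (fun t s => γ t s) =ᶠ[𝓝 0] fun _ => (0 : ℝ) := by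
      filter_upwards [Ioo_mem_nhds (neg_lt_zero.2 hε) hε] with t ht
      exact hγM t ht j
    have h3 := (h1.congr_of_eventuallyEq h2.symm).unique (hasDerivAt_const 0 0)
    rw [hγ0] at h3
    rw [mul_eq_zero]
    right
    simpa using h3

section Slack

variable {n k : ℕ} (f : Fin k → MvPolynomial (Fin n) ℝ) (β : ℝ)

theorem aeval_slackSystem (z : Fin n ⊕ Fin k → ℝ) (i : Fin k) :
    MvPolynomial.aeval z (slackSystem f β i) =
      MvPolynomial.aeval (z ∘ Sum.inl) (f i) + 1 / √β * z (Sum.inr i) := by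
  simp only [slackSystem, map_add, map_mul, MvPolynomial.aeval_X, MvPolynomial.aeval_C,
    MvPolynomial.aeval_rename]
  rfl

theorem aeval_pderiv_inl_slackSystem (z : Fin n ⊕ Fin k → ℝ) (s : Fin n) (i : Fin k) :
    MvPolynomial.aeval z (MvPolynomial.pderiv (Sum.inl s) (slackSystem f β i)) =
      MvPolynomial.aeval (z ∘ Sum.inl) (MvPolynomial.pderiv s (f i)) := by
  simp [slackSystem, MvPolynomial.pderiv_rename Sum.inl_injective, MvPolynomial.pderiv_X,
    MvPolynomial.aeval_rename]

theorem aeval_pderiv_inr_slackSystem (z : Fin n ⊕ Fin k → ℝ) (j i : Fin k) :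
    MvPolynomial.aeval z (MvPolynomial.pderiv (Sum.inr j) (slackSystem f β i)) =
      if i = j then 1 / √β else 0 := by
  have : (MvPolynomial.C (√β)⁻¹ : MvPolynomial (Fin n ⊕ Fin k) ℝ) *
      MvPolynomial.pderiv (Sum.inr j) (MvPolynomial.X (Sum.inr i)) =
      MvPolynomial.C (if i = j then (√β)⁻¹ else 0) := by
    rcases eq_or_ne i j with rfl | hij
    · simp
    · rw [MvPolynomial.pderiv_X_of_ne (by simpa using hij)]
      simp [hij]
  rw [slackSystem, map_add, MvPolynomial.pderiv_inr_rename_inl, MvPolynomial.pderiv_C_mul, zero_add,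
    one_div, this, MvPolynomial.aeval_C]
  rfl

/-- The slack coordinates recover the multipliers. This yields independence of the gradients,
uniqueness of $\lambda$, and its bound by $\|v\|$. -/
theorem gradComb_slackSystem_inr (p : EuclideanSpace ℝ (Fin n ⊕ Fin k)) (lam : Fin k → ℝ)
    (j : Fin k) : gradComb (slackSystem f β) p lam (Sum.inr j) = lam j / √β := by
  simp only [gradComb, aeval_pderiv_inr_slackSystem]
  simp [div_eq_inv_mul]

/-- The coordinates `(x, w) ↦ (x, h(x, w))` straightening the zero set of the slack system. -/
def slackChart (p : EuclideanSpace ℝ (Fin n ⊕ Fin k)) : EuclideanSpace ℝ (Fin n ⊕ Fin k) :=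
  WithLp.toLp 2 (Sum.elim (fun s => p (Sum.inl s))
    (fun i => MvPolynomial.aeval (fun s => p s) (slackSystem f β i)))

/-- The inverse of `slackChart`. -/
def slackChartInv (q : EuclideanSpace ℝ (Fin n ⊕ Fin k)) : EuclideanSpace ℝ (Fin n ⊕ Fin k) :=
  WithLp.toLp 2 (Sum.elim (fun s => q (Sum.inl s))
    (fun i => √β * (q (Sum.inr i) - MvPolynomial.aeval (fun s => q (Sum.inl s)) (f i))))

theorem contDiff_slackChart : ContDiff ℝ ∞ (slackChart f β) := by
  refine contDiff_euclidean.2 ?_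
  rintro (s | i)
  · exact (show ContDiff ℝ ∞ fun p : EuclideanSpace ℝ (Fin n ⊕ Fin k) => p (Sum.inl s) by fun_prop)
  · exact ((slackSystem f β i).contDiff_aeval ∞).comp
      (show ContDiff ℝ ∞ fun (p : EuclideanSpace ℝ (Fin n ⊕ Fin k)) s => p s by fun_prop)

theorem contDiff_slackChartInv : ContDiff ℝ ∞ (slackChartInv f β) := by
  refine contDiff_euclidean.2 ?_
  rintro (s | i)
  · exact (show ContDiff ℝ ∞ fun p : EuclideanSpace ℝ (Fin n ⊕ Fin k) => p (Sum.inl s) by fun_prop)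
  · exact contDiff_const.mul ((show ContDiff ℝ ∞ fun p : EuclideanSpace ℝ (Fin n ⊕ Fin k) =>
      p (Sum.inr i) by fun_prop).sub (((f i).contDiff_aeval ∞).comp
      (show ContDiff ℝ ∞ fun (p : EuclideanSpace ℝ (Fin n ⊕ Fin k)) s => p (Sum.inl s) by fun_prop)))

variable {β}

theorem slackChartInv_slackChart (hβ : 0 < β) (p : EuclideanSpace ℝ (Fin n ⊕ Fin k)) :
    slackChartInv f β (slackChart f β p) = p := by
  have : √β ≠ 0 := (Real.sqrt_pos.2 hβ).ne'
  ext (s | i)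
  · rfl
  · simp only [slackChart, slackChartInv, aeval_slackSystem, Sum.elim_inl, Sum.elim_inr,
      Function.comp_def]
    field_simp
    ring

theorem slackChart_slackChartInv (hβ : 0 < β) (q : EuclideanSpace ℝ (Fin n ⊕ Fin k)) :
    slackChart f β (slackChartInv f β q) = q := by
  have : √β ≠ 0 := (Real.sqrt_pos.2 hβ).ne'
  ext (s | i)
  · rfl
  · simp only [slackChart, slackChartInv, aeval_slackSystem, Sum.elim_inl, Sum.elim_inr,
      Function.comp_def]
    field_simp
    ring

/-- One global chart serves every point: `slackChart` carries the zero set onto the subspace where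
the last $k$ coordinates vanish. -/
theorem isEmbeddedSubmanifold_slackSystem (hβ : 0 < β) :
    IsEmbeddedSubmanifold n (realZeroSet (slackSystem f β)) := by
  intro p _
  let e : EuclideanSpace ℝ (Fin n ⊕ Fin k) ≃ₜ EuclideanSpace ℝ (Fin n ⊕ Fin k) :=
    { toFun := slackChart f β
      invFun := slackChartInv f β
      left_inv := slackChartInv_slackChart f hβ
      right_inv := slackChart_slackChartInv f hβ
      continuous_toFun := (contDiff_slackChart f β).continuous
      continuous_invFun := (contDiff_slackChartInv f β).continuous }
  let S : Submodule ℝ (EuclideanSpace ℝ (Fin n ⊕ Fin k)) :=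
    { carrier := {q | ∀ i : Fin k, q (Sum.inr i) = 0}
      add_mem' := fun ha hb i => by simp [ha i, hb i]
      zero_mem' := fun i => rfl
      smul_mem' := fun a q hq i => by simp [hq i] }
  let L : S ≃ₗ[ℝ] (Fin n → ℝ) :=
    { toFun := fun q s => q.1 (Sum.inl s)
      invFun := fun x => ⟨WithLp.toLp 2 (Sum.elim x 0), fun i => rfl⟩
      map_add' := fun a b => rfl
      map_smul' := fun a b => rfl
      left_inv := fun q => by
        ext (s | i)
        · rfl
        · exact (q.2 i).symm
      right_inv := fun x => rfl }
  exact ⟨e.toOpenPartialHomeomorph, S, Set.mem_univ _, (contDiff_slackChart f β).contDiffOn,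
    (contDiff_slackChartInv f β).contDiffOn, by rw [L.finrank_eq, Module.finrank_fin_fun],
    fun q _ => Iff.rfl⟩

/-- The normal vectors of the zero set of the slack system are combinations of the gradients. -/
theorem eq_neg_gradComb_of_mem_normalSpace (hβ : 0 < β) {p v : EuclideanSpace ℝ (Fin n ⊕ Fin k)}
    (hp : p ∈ realZeroSet (slackSystem f β))
    (hv : v ∈ normalSpace (realZeroSet (slackSystem f β)) p) :
    v = -gradComb (slackSystem f β) p (fun j => -√β * v (Sum.inr j)) := by
  have hβ' : √β ≠ 0 := (Real.sqrt_pos.2 hβ).ne'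
  ext (s | j)
  · let x : Fin n → ℝ := fun t => p (Sum.inl t)
    -- Moving $x_s$ alone along the graph gives the tangent vector
    -- $u=(e_s,-\sqrt\beta\,\partial_sf)$; $v\perp u$ expresses $v_{x_s}$ through the slack
    -- coordinates of $v$.
    let ξ : ℝ → Fin n → ℝ := fun t => x + t • Pi.single s 1
    let γ : ℝ → EuclideanSpace ℝ (Fin n ⊕ Fin k) := fun t =>
      slackChartInv f β (WithLp.toLp 2 (Sum.elim (ξ t) 0))
    let u : EuclideanSpace ℝ (Fin n ⊕ Fin k) := WithLp.toLp 2 (Sum.elim (Pi.single s 1)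
      (fun j => √β * -MvPolynomial.aeval x (MvPolynomial.pderiv s (f j))))
    have hξ0 : ξ 0 = x := by simp [ξ]
    have hξ : HasDerivAt ξ (Pi.single s 1) 0 := by
      have h1 := ((hasDerivAt_id (0 : ℝ)).smul_const (Pi.single s 1 : Fin n → ℝ)).const_add x
      rwa [one_smul] at h1
    have hγ : ContDiff ℝ ∞ γ := by
      refine (contDiff_slackChartInv f β).comp (contDiff_euclidean.2 ?_)
      rintro (t | j)
      · exact (show ContDiff ℝ ∞ fun r : ℝ => x t + r * (Pi.single s 1 : Fin n → ℝ) t by fun_prop)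
      · exact contDiff_const
    have hu : HasDerivAt γ u 0 := by
      refine (PiLp.continuousLinearEquiv 2 ℝ
        (fun _ : Fin n ⊕ Fin k => ℝ)).symm.toContinuousLinearMap.hasFDerivAt.comp_hasDerivAt 0
        (f := fun t => (γ t).ofLp) (f' := u.ofLp) (hasDerivAt_pi.2 ?_)
      rintro (t | j)
      · exact hasDerivAt_pi.1 hξ t
      · have h1 := ((f j).hasStrictFDerivAt_aeval (ξ 0)).hasFDerivAt.comp_hasDerivAt 0 hξ
        have h2 := (h1.const_sub 0).const_mul √β
        convert! h2 using 1
        simp [u, hξ0, Pi.single_apply]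
    have htan : IsTangentVector (realZeroSet (slackSystem f β)) p u := by
      refine ⟨γ, 1, one_pos, hγ.contDiffOn, fun t _ i => ?_, ?_, hu⟩
      · exact congrFun (congrArg WithLp.ofLp (slackChart_slackChartInv f hβ
          (WithLp.toLp 2 (Sum.elim (ξ t) 0)))) (Sum.inr i)
      · have h0 : WithLp.toLp 2 (Sum.elim (ξ 0) 0) = slackChart f β p := by
          rw [hξ0]
          ext (t | i)
          · rfl
          · exact (hp i).symm
        change slackChartInv f β (WithLp.toLp 2 (Sum.elim (ξ 0) 0)) = p
        rw [h0, slackChartInv_slackChart f hβ]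
    have h0 := (Submodule.mem_orthogonal _ _).1 hv u (Submodule.subset_span htan)
    rw [PiLp.inner_apply, Fintype.sum_sum_type] at h0
    simp only [RCLike.inner_apply, conj_trivial, u, Sum.elim_inl, Sum.elim_inr, Pi.single_apply,
      mul_ite, mul_one, mul_zero, Finset.sum_ite_eq', Finset.mem_univ, if_true] at h0
    simp only [gradComb, PiLp.neg_apply, aeval_pderiv_inl_slackSystem]
    rw [← Finset.sum_neg_distrib, eq_neg_of_add_eq_zero_left h0, ← Finset.sum_neg_distrib]
    refine Finset.sum_congr rfl fun j _ => ?_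
    simp only [Function.comp_def, x]
    ring
  · rw [PiLp.neg_apply, gradComb_slackSystem_inr]
    field_simp

theorem exists_tube_slackSystem (hβ : 0 < β) :
    ∃ δ : EuclideanSpace ℝ (Fin n ⊕ Fin k) → ℝ, Continuous δ ∧ (∀ p, 0 < δ p) ∧
      ∀ q ∈ normalTube (realZeroSet (slackSystem f β)) δ,
        (∃ lam, IsSimpleZero (lagrangeSystem (slackSystem f β) (fun s => (q.1 + q.2) s))
          (Sum.elim (fun s => q.1 s) lam)) ∧
        ∀ p ∈ realZeroSet (slackSystem f β), p ≠ q.1 →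
          dist (q.1 + q.2) q.1 < dist (q.1 + q.2) p := by
  obtain ⟨C, hC, hC0, hC1, hC2⟩ := MvPolynomial.exists_continuous_bound (slackSystem f β)
  have hden (p) : 0 < 2 * (k * √β * C p + 1) := by
    have := hC0 p
    positivity
  -- Since $\sum_j|\lambda_j|\le k\sqrt\beta\,\|v\|$, this radius gives
  -- $k\sqrt\beta\,C(p)\|v\|+\|v\|<1/2$, which bounds both $(\sum_j|\lambda_j|)C(p)$ and $\|v\|$ by
  -- $1/2$.
  refine ⟨fun p => 1 / (2 * (k * √β * C p + 1)),
    continuous_const.div (by fun_prop) fun p => (hden p).ne', fun p => one_div_pos.2 (hden p), ?_⟩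
  rintro ⟨p, v⟩ ⟨⟨hp, hv⟩, hlt⟩
  dsimp only at hp hv hlt ⊢
  set lam : Fin k → ℝ := fun j => -√β * v (Sum.inr j) with hlamdef
  have hvg : v = -gradComb (slackSystem f β) p lam := eq_neg_gradComb_of_mem_normalSpace f hβ hp hv
  rw [lt_div_iff₀ (hden p)] at hlt
  have hsum : ∑ j, |lam j| ≤ k * √β * ‖v‖ := by
    have hle (j : Fin k) : |lam j| ≤ √β * ‖v‖ := by
      rw [hlamdef, abs_mul, abs_neg, abs_of_nonneg (Real.sqrt_nonneg β)]
      exact mul_le_mul_of_nonneg_left (by simpa using PiLp.norm_apply_le v (Sum.inr j))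
        (Real.sqrt_nonneg β)
    refine (Finset.sum_le_sum fun j _ => hle j).trans (le_of_eq ?_)
    simp [mul_assoc]
  have hprod : (∑ j, |lam j|) * C p ≤ k * √β * C p * ‖v‖ := by
    refine (mul_le_mul_of_nonneg_right hsum (hC0 p)).trans (le_of_eq ?_)
    ring
  have hnn : 0 ≤ k * √β * C p * ‖v‖ := by
    have := hC0 p
    positivity
  have hlam : (∑ j, |lam j|) * C p < 1 / 2 := by nlinarith [norm_nonneg v]
  have hvn : ‖v‖ < 1 / 2 := by nlinarith
  have hli (mu : Fin k → ℝ) (hmu : gradComb (slackSystem f β) p mu = 0) : mu = 0 := by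
    funext j
    have := congrFun (congrArg WithLp.ofLp hmu) (Sum.inr j)
    rw [gradComb_slackSystem_inr] at this
    exact (div_eq_zero_iff.1 this).resolve_right (Real.sqrt_pos.2 hβ).ne'
  refine ⟨⟨lam, ?_⟩, fun q hq hne => ?_⟩
  · exact isSimpleZero_lagrangeSystem (C := C p) (fun j => hC2 j p) (by linarith) hli
      (isZeroOf_lagrangeSystem_iff.2 ⟨hp, by rw [← hvg]⟩)
  · rw [hvg]
    exact dist_lt_dist_of_gradComb (fun j q => hC1 j p q) hp hq hne hlam
      (by rwa [hvg, norm_neg] at hvn)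

end Slack

end

theorem mainTheorem3 (n k : ℕ) (f : Fin k → MvPolynomial (Fin n) ℝ) (β : ℝ) (hβ : 0 < β) :
    IsEmbeddedSubmanifold n (realZeroSet (slackSystem f β)) ∧
    ∃ U : Set (EuclideanSpace ℝ (Fin n ⊕ Fin k)),
      IsTubularNeighborhood (realZeroSet (slackSystem f β)) U ∧
      ∀ c ∈ U, ∃ p : EuclideanSpace ℝ (Fin n ⊕ Fin k),
        IsClosestPoint (realZeroSet (slackSystem f β)) c p ∧
        (∀ p', IsClosestPoint (realZeroSet (slackSystem f β)) c p' → p' = p) ∧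
        ∃ lam : Fin k → ℝ,
          IsIsolatedZero (lagrangeSystem (slackSystem f β) (fun s => c s))
            (Sum.elim (fun s => p s) lam) ∧
          IsSimpleZero (lagrangeSystem (slackSystem f β) (fun s => c s))
            (Sum.elim (fun s => p s) lam) ∧
          ∀ lam' : Fin k → ℝ,
            IsZeroOf ℝ (lagrangeSystem (slackSystem f β) (fun s => c s))
              (Sum.elim (fun s => p s) lam') → lam' = lam := by
  refine ⟨isEmbeddedSubmanifold_slackSystem f hβ, ?_⟩
  obtain ⟨δ, hδ, hpos, htube⟩ := exists_tube_slackSystem f hβ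
  refine ⟨_, isTubularNeighborhood_image hδ hpos
    (fun p _ lam => Submodule.neg_mem _ (gradComb_mem_normalSpace _ p lam))
    (fun q hq => (htube q hq).1) (fun q hq => (htube q hq).2), ?_⟩
  rintro _ ⟨q, hq, rfl⟩
  obtain ⟨⟨lam, hlam⟩, hclosest⟩ := htube q hq
  refine ⟨q.1, ⟨hq.1.1, fun p hp => ?_⟩, fun p hp => ?_, lam, hlam.isIsolatedZero, hlam,
    fun lam' hlam' => ?_⟩
  · rcases eq_or_ne p q.1 with rfl | hne
    · exact le_rfl
    · exact (hclosest p hp hne).le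
  · by_contra hne
    exact (hclosest p hp.1 hne).not_ge (hp.2 q.1 hq.1.1)
  · funext j
    have h1 := (isZeroOf_lagrangeSystem_iff.1 hlam.1).2
    have h2 := (isZeroOf_lagrangeSystem_iff.1 hlam').2
    -- Both multiplier vectors give the same normal vector $c-p$, whose slack coordinates determine
    -- them.
    have h3 := congrFun (congrArg WithLp.ofLp (neg_injective (add_left_cancel (h2.symm.trans h1))))
      (Sum.inr j)
    rw [gradComb_slackSystem_inr, gradComb_slackSystem_inr] at h3
    exact (div_left_inj' (Real.sqrt_pos.2 hβ).ne').1 h3
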